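/- Let $A$ be a noetherian commutative ring and let $f = u^n + a_1 u^{n-1} + \cdots + a_n \in A[u]$ be a monic polynomial with discriminant $\Delta \in A$. Let $$\mathrm{Split}_A(f) = A[\xi_1,\ldots,\xi_n]/\bigl(a_i - (-1)^i e_i(\xi_1,\ldots,\xi_n) : 1 \le i \le n\bigr)$$ be the splitting ring of $f$, where $e_i$ is the $i$th elementary symmetric polynomial. Let $V(\Delta,\partial\Delta) \subset \mathrm{Spec}(A)$ be the set of points $x$ at which $\Delta$ vanishes to order two, i.e. such that the image of $\Delta$ in the local ring of $\mathrm{Spec}(A)$ at $x$ belongs to $\mathfrak{m}_x^2$, with $\mathfrak{m}_x$ the maximal ideal of that local ring. (A ring is normal if its localizations at all prime ideals are integrally closed domains.) Suppose that (a) $A$ is normal, (b) $\Delta$ is a non-zerodivisor in $A$, and (c) $V(\Delta,\partial\Delta)$ has codimension $\ge 2$, i.e. every prime of $A$ belonging to it has height $\ge 2$. Then $\Delta$ is squarefree, in the sense that for every height one prime $\mathfrak{p}$ of $A$ (for which $A_\mathfrak{p}$ is a discrete valuation ring, with normalized valuation $v_\mathfrak{p}$) one has $v_\mathfrak{p}(\Delta)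 \in \{0,1\}$; and the ring $\mathrm{Split}_A(f)$ is normal. -/

import Mathlib

open Polynomial

/-- A commutative ring is *normal* if its localization at every prime ideal is an
integrally closed domain. (The ring itself need not be a domain.) -/
def IsNormalRing (R : Type*) [CommRing R] : Prop :=
  ∀ (p : Ideal R) [p.IsPrime],
    IsDomain (Localization.AtPrime p) ∧ IsIntegrallyClosed (Localization.AtPrime p)

/-- The ideal of relations of the splitting ring of a monic polynomial
`f = u ^ n + a₁ u ^ (n - 1) + ⋯ + aₙ`: it is generated by the elements
`a_i - (-1) ^ i e_i(ξ₁, …, ξₙ)` for `1 ≤ i ≤ n`. -/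
noncomputable def splittingIdeal {A : Type*} [CommRing A] (f : A[X]) :
    Ideal (MvPolynomial (Fin f.natDegree) A) :=
  Ideal.span {r | ∃ i : ℕ, 1 ≤ i ∧ i ≤ f.natDegree ∧
    r = MvPolynomial.C (f.coeff (f.natDegree - i)) -
      (-1) ^ i * MvPolynomial.esymm (Fin f.natDegree) A i}

/-- The *splitting ring* `A[ξ₁, …, ξₙ] / (a_i - (-1) ^ i e_i(ξ) : 1 ≤ i ≤ n)`
of a monic polynomial `f` of degree `n`. -/
abbrev SplittingRing {A : Type*} [CommRing A] (f : A[X]) : Type _ :=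
  MvPolynomial (Fin f.natDegree) A ⧸ splittingIdeal f

/-- The set of points `x` of `Spec A` at which `a` vanishes to order two, i.e. such that
the image of `a` in the local ring at `x` lies in the square of the maximal ideal. -/
def vanishingOrderTwoLocus {A : Type*} [CommRing A] (a : A) : Set (PrimeSpectrum A) :=
  {x | algebraMap A (Localization.AtPrime x.asIdeal) a ∈
    IsLocalRing.maximalIdeal (Localization.AtPrime x.asIdeal) ^ 2}

/-- A subset of `Spec A` has codimension `≥ c` if all the primes it contains have
height `≥ c`. -/
def HasCodimAtLeast {A : Type*} [CommRing A] (S : Set (PrimeSpectrum A)) (c : ℕ∞) : Prop :=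
  ∀ x ∈ S, c ≤ x.asIdeal.height

/-- An element `a` of a noetherian normal ring `R` is *squarefree* if `v_p(a) ∈ {0, 1}` for
every prime `p` of height one, where `v_p` is the normalized valuation of the discrete
valuation ring `R_p`. -/
def IsSquarefreeElement {R : Type*} [CommRing R] (a : R) : Prop :=
  ∀ (p : Ideal R) [p.IsPrime], p.height = 1 →
    ∃ (_ : IsDomain (Localization.AtPrime p))
      (_ : IsDiscreteValuationRing (Localization.AtPrime p)),
      IsDiscreteValuationRing.addVal (Localization.AtPrime p)
          (algebraMap R (Localization.AtPrime p) a) = 0 ∨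
        IsDiscreteValuationRing.addVal (Localization.AtPrime p)
          (algebraMap R (Localization.AtPrime p) a) = 1

/-! Normality can be tested after localizing the base, so let R be a local ring of A, an integrally
closed noetherian domain with fraction field K, and let B be the splitting ring over R. It is flat,
hence embeds in K ⊗ B, which is reduced and Artinian because Δ ≠ 0 makes f separable over K.

The heart is that B is integrally closed in K ⊗ B (`exists_one_tmul_eq_of_isIntegral`). Each
ordering σ of the roots in a splitting field L gives a point φ_σ : K ⊗ B → L. For integral x the
alternating sum Σ sgn(σ) φ_σ(x) equals tδ, where δ is the Vandermonde determinant and t ∈ K by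
Galois invariance. Its square Δt² is integral, and (c) then forces t ∈ R
(`HasCodimAtLeast.exists_algebraMap_eq`). Interpolation over the orderings
(`sum_interpolationKernel`) writes δb through such sums; cancelling δ exhibits b as an R-combination
of monomials in the roots.

Hence the idempotents of K ⊗ B lie in B, so the local rings of B are domains, and integral
closedness passes to them (`IsSplittingAlgebra.isNormalRing`). Squarefreeness of Δ is (c) read at
height one primes. -/

open scoped TensorProduct

universe u

/-! ### Discriminants of monic polynomials -/

namespace Polynomial

/-- Over a nontrivial target, the discriminant of a monic polynomial commutes with base change. -/
theorem Monic.discr_map {A B : Type*} [CommRing A] [CommRing B] [Nontrivial B] {f : A[X]}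
    (hf : f.Monic) (φ : A →+* B) : (f.map φ).discr = φ f.discr := by
  have hA : Nontrivial A := φ.domain_nontrivial
  have hdeg : (f.map φ).natDegree = f.natDegree := hf.natDegree_map φ
  rcases Nat.eq_zero_or_pos f.natDegree with h0 | hpos
  · rw [hf.natDegree_eq_zero.1 h0]
    simpa using (discr_C (1 : B)).trans (by rw [← C_1, discr_C, map_one])
  -- The resultant is taken with formal degrees n and n - 1, so it commutes with base change even
  -- where the derivative drops degree.
  · have h1 := resultant_deriv (natDegree_pos_iff_degree_pos.1 hpos)
    have h2 := resultant_deriv (f := f.map φ) (natDegree_pos_iff_degree_pos.1 (hdeg ▸ hpos))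
    rw [hdeg, derivative_map, resultant_map_map, h1, (hf.map φ).leadingCoeff, hf.leadingCoeff] at h2
    simp only [map_mul, map_pow, map_neg, map_one, mul_one] at h2
    have hu : IsUnit ((-1 : B) ^ (f.natDegree * (f.natDegree - 1) / 2)) :=
      (isUnit_one.neg).pow _
    exact (hu.mul_left_cancel h2).symm

/-- The discriminant of a split monic polynomial is the square of the Vandermonde determinant
of its roots. -/
theorem discr_prod_X_sub_C {L : Type*} [Field L] {n : ℕ} (α : Fin n → L) :
    (∏ i, (X - C (α i))).discr = (Matrix.vandermonde α).det ^ 2 := by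
  set f : L[X] := ∏ i, (X - C (α i)) with hfdef
  have hf : f.Monic := monic_prod_of_monic _ _ fun i _ => monic_X_sub_C _
  have hdeg : f.natDegree = n := by simp [hfdef]
  rcases Nat.eq_zero_or_pos n with rfl | hpos
  · have : f = C 1 := by simp [hfdef]
    rw [this, discr_C]
    simp
  have hroots : f.roots = Finset.univ.val.map α := by
    rw [hfdef, Finset.prod_eq_multiset_prod,
      ← roots_multiset_prod_X_sub_C (Finset.univ.val.map α), Multiset.map_map]
    rfl
  have hsplit : f.Splits := by
    rw [hfdef]
    exact Splits.prod fun i _ => Splits.X_sub_C _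
  have h1 := resultant_deriv (f := f) (natDegree_pos_iff_degree_pos.1 (hdeg.symm ▸ hpos))
  have heval (i : Fin n) : f.derivative.eval (α i) = ∏ j ∈ Finset.univ.erase i, (α i - α j) := by
    rw [hfdef, derivative_prod_finset, eval_finsetSum, Finset.sum_eq_single i]
    · simp [eval_prod]
    · intro j _ hj
      simp only [eval_mul, eval_prod]
      rw [Finset.prod_eq_zero (Finset.mem_erase.2 ⟨hj.symm, Finset.mem_univ i⟩) (by simp), zero_mul]
    · simp
  have h2 : resultant f f.derivative f.natDegree (f.natDegree - 1) =
      ∏ i, ∏ j ∈ Finset.univ.erase i, (α i - α j) := by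
    rw [resultant_eq_prod_eval _ _ _ (natDegree_derivative_le f) hsplit, hf.leadingCoeff, hroots,
      Multiset.map_map, one_pow, one_mul]
    exact Finset.prod_congr rfl fun i _ => heval i
  have h3 : ∏ i, ∏ j ∈ Finset.univ.erase i, (α i - α j) =
      (-1) ^ (n * (n - 1) / 2) * (Matrix.vandermonde α).det ^ 2 := by
    have hsplit (i : Fin n) : ∏ j ∈ Finset.univ.erase i, (α i - α j) =
        (∏ j ∈ Finset.Ioi i, (α i - α j)) * ∏ j ∈ Finset.Iio i, (α i - α j) := by
      rw [← Finset.prod_union]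
      · congr 1
        ext j
        simp [lt_or_lt_iff_ne, ne_comm]
      · exact Finset.disjoint_left.2 fun j h h' =>
          lt_asymm (Finset.mem_Ioi.1 h) (Finset.mem_Iio.1 h')
    have hneg : ∏ i : Fin n, ∏ j ∈ Finset.Ioi i, (α i - α j) =
        (-1) ^ (n * (n - 1) / 2) * (Matrix.vandermonde α).det := by
      have : ∀ i : Fin n, ∏ j ∈ Finset.Ioi i, (α i - α j) =
          (-1) ^ (n - 1 - (i : ℕ)) * ∏ j ∈ Finset.Ioi i, (α j - α i) := by
        intro i
        rw [← Fin.card_Ioi, ← Finset.prod_const, ← Finset.prod_mul_distrib]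
        exact Finset.prod_congr rfl fun j _ => by ring
      rw [Finset.prod_congr rfl fun i _ => this i, Finset.prod_mul_distrib,
        Matrix.det_vandermonde, Finset.prod_pow_eq_pow_sum,
        Fin.sum_univ_eq_sum_range (fun i => n - 1 - i), Finset.sum_range_reflect (fun i => i),
        Finset.sum_range_id]
    have hswap : ∏ i : Fin n, ∏ j ∈ Finset.Iio i, (α i - α j) = (Matrix.vandermonde α).det := by
      rw [Matrix.det_vandermonde]
      exact Finset.prod_comm' (by simp)
    rw [Finset.prod_congr rfl fun i _ => hsplit i, Finset.prod_mul_distrib, hneg, hswap]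
    ring
  rw [h2, h3, hdeg, hf.leadingCoeff, mul_one] at h1
  exact (((isUnit_one.neg).pow _).mul_left_cancel h1).symm

end Polynomial

/-! ### Splitting rings: universal property and flatness -/

/-- Every monic polynomial of degree `n` acquires a universal factorization into linear factors
over some flat algebra. -/
theorem exists_flat_universal_splitting {n : ℕ} : ∀ {A : Type u} [CommRing A] {f : A[X]},
    f.Monic → f.natDegree = n →
    ∃ (T : Type u) (_ : CommRing T) (_ : Algebra A T) (η : Fin n → T),
      Module.Flat A T ∧ f.map (algebraMap A T) = ∏ i, (X - C (η i)) ∧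
      ∀ (S : Type u) [CommRing S] [Algebra A S] (β : Fin n → S),
        f.map (algebraMap A S) = ∏ i, (X - C (β i)) → ∃ φ : T →ₐ[A] S, ∀ i, φ (η i) = β i := by
  induction n with
  | zero =>
    intro A _ f hf hn
    refine ⟨A, inferInstance, inferInstance, Fin.elim0, inferInstance, ?_, ?_⟩
    · simp [hf.natDegree_eq_zero.1 hn]
    · intro S _ _ β _
      exact ⟨Algebra.ofId A S, fun i => i.elim0⟩
  | succ n ih =>
    intro A _ f hf hn
    -- Adjoin one root freely, divide by its linear factor, and apply induction to the quotient g
    -- over `AdjoinRoot f`.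
    have hroot : (f.map (algebraMap A (AdjoinRoot f))).IsRoot (AdjoinRoot.root f) :=
      AdjoinRoot.isRoot_root f
    obtain ⟨g, hg⟩ := dvd_iff_isRoot.2 hroot
    have hgm : g.Monic := (monic_X_sub_C (AdjoinRoot.root f)).of_mul_monic_left (hg ▸ hf.map _)
    have hfree : Module.Free A (AdjoinRoot f) := hf.free_adjoinRoot
    have hgn : g.natDegree = n := by
      have hA : Nontrivial A := by
        by_contra h
        rw [not_nontrivial_iff_subsingleton] at h
        simp [Subsingleton.elim f 0] at hn
      have hnt : Nontrivial (AdjoinRoot f) := by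
        refine Ideal.Quotient.nontrivial_iff.2 fun h => ?_
        rw [Ideal.span_singleton_eq_top, hf.isUnit_iff] at h
        simp [h] at hn
      have := congrArg natDegree hg
      rw [hf.natDegree_map, (monic_X_sub_C _).natDegree_mul hgm, natDegree_X_sub_C, hn] at this
      omega
    obtain ⟨T, _, _, η, hT, hη, hlift⟩ := ih hgm hgn
    let : Algebra A T := Algebra.compHom T (algebraMap A (AdjoinRoot f))
    have : IsScalarTower A (AdjoinRoot f) T := IsScalarTower.of_algebraMap_eq' rfl
    refine ⟨T, inferInstance, inferInstance,
      Fin.cons (algebraMap (AdjoinRoot f) T (AdjoinRoot.root f)) η,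
      Module.Flat.trans A (AdjoinRoot f) T, ?_, ?_⟩
    · rw [IsScalarTower.algebraMap_eq A (AdjoinRoot f) T, ← Polynomial.map_map, hg,
        Polynomial.map_mul, hη, Fin.prod_univ_succ]
      simp
    · intro S _ _ β hβ
      have h0 : aeval (β 0) f = 0 := by
        rw [aeval_def, ← eval_map, hβ, Fin.prod_univ_succ]
        simp
      let ψ : AdjoinRoot f →ₐ[A] S := AdjoinRoot.liftAlgHom f (Algebra.ofId A S) (β 0) h0
      let : Algebra (AdjoinRoot f) S := ψ.toRingHom.toAlgebra
      have : IsScalarTower A (AdjoinRoot f) S :=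
        IsScalarTower.of_algebraMap_eq' ψ.comp_algebraMap.symm
      have hψ : algebraMap (AdjoinRoot f) S (AdjoinRoot.root f) = β 0 :=
        AdjoinRoot.liftAlgHom_root ..
      obtain ⟨φ, hφ⟩ := hlift S (fun i => β i.succ) (by
        apply (monic_X_sub_C (β 0)).isRegular.left
        have := hβ
        rw [IsScalarTower.algebraMap_eq A (AdjoinRoot f) S, ← Polynomial.map_map, hg,
          Polynomial.map_mul, Fin.prod_univ_succ] at this
        simpa [hψ] using this)
      refine ⟨φ.restrictScalars A, Fin.cases ?_ ?_⟩
      · simp [hψ]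
      · simpa using hφ

theorem coeff_prod_X_sub_C {S : Type*} [CommRing S] {n : ℕ} (β : Fin n → S) {i : ℕ} (hi : i ≤ n) :
    (∏ j, (X - C (β j))).coeff (n - i) = (-1) ^ i * (Finset.univ.val.map β).esymm i := by
  have hcard : Multiset.card (Finset.univ.val.map β) = n := by simp
  have h := Multiset.prod_X_sub_C_coeff (Finset.univ.val.map β) (k := n - i) (by rw [hcard]; omega)
  rw [hcard, Nat.sub_sub_self hi, Multiset.map_map] at h
  exact h

/-- `B` is generated over `A` by a full system `ξ` of roots of `f`, and every full system of roots
of `f` in a field is a specialization of `ξ`. -/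
structure IsSplittingAlgebra {A B : Type u} [CommRing A] [CommRing B] [Algebra A B] (f : A[X])
    {n : ℕ} (ξ : Fin n → B) : Prop where
  map_eq : f.map (algebraMap A B) = ∏ i, (X - C (ξ i))
  adjoin_eq_top : Algebra.adjoin A (Set.range ξ) = ⊤
  exists_lift : ∀ (L : Type u) [Field L] [Algebra A L] (α : Fin n → L),
    f.map (algebraMap A L) = ∏ i, (X - C (α i)) → ∃ φ : B →ₐ[A] L, ∀ i, φ (ξ i) = α i

namespace SplittingRing

variable {A : Type u} [CommRing A] (f : A[X])

/-- The universal roots of `f` in its splitting ring. -/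
noncomputable def root (i : Fin f.natDegree) : SplittingRing f :=
  Ideal.Quotient.mk (splittingIdeal f) (MvPolynomial.X i)

theorem adjoin_root : Algebra.adjoin A (Set.range (root f)) = ⊤ := by
  have h := congrArg (Subalgebra.map (Ideal.Quotient.mkₐ A (splittingIdeal f)))
    (MvPolynomial.adjoin_range_X (R := A) (σ := Fin f.natDegree))
  rw [AlgHom.map_adjoin, ← Set.range_comp, Algebra.map_top,
    (AlgHom.range_eq_top _).2 (Ideal.Quotient.mkₐ_surjective A _)] at h
  exact h

theorem esymm_root {i : ℕ} : Ideal.Quotient.mk (splittingIdeal f)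
    (MvPolynomial.esymm (Fin f.natDegree) A i) = (Finset.univ.val.map (root f)).esymm i := by
  rw [← MvPolynomial.aeval_esymm_eq_multiset_esymm (Fin f.natDegree) A]
  have : Ideal.Quotient.mkₐ A (splittingIdeal f) = MvPolynomial.aeval (root f) :=
    MvPolynomial.algHom_ext fun i => by simp [root]
  exact DFunLike.congr_fun this _

variable {f}

theorem map_eq_prod (hf : f.Monic) :
    f.map (algebraMap A (SplittingRing f)) = ∏ i, (X - C (root f i)) := by
  ext k
  rw [coeff_map]
  rcases lt_or_ge f.natDegree k with hk | hk
  · rw [coeff_eq_zero_of_natDegree_lt hk, map_zero, coeff_eq_zero_of_natDegree_lt]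
    refine (natDegree_prod_le _ _).trans_lt (lt_of_le_of_lt ?_ hk)
    exact (Finset.sum_le_card_nsmul _ _ 1 fun i _ => natDegree_X_sub_C_le _).trans (by simp)
  · obtain ⟨i, hi, rfl⟩ : ∃ i, i ≤ f.natDegree ∧ k = f.natDegree - i :=
      ⟨f.natDegree - k, Nat.sub_le _ _, (Nat.sub_sub_self hk).symm⟩
    rw [coeff_prod_X_sub_C _ hi]
    rcases Nat.eq_zero_or_pos i with rfl | hpos
    · simp [hf, Multiset.esymm]
    · have hmem : MvPolynomial.C (f.coeff (f.natDegree - i)) -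
          (-1) ^ i * MvPolynomial.esymm (Fin f.natDegree) A i ∈ splittingIdeal f :=
        Ideal.subset_span ⟨i, hpos, hi, rfl⟩
      have h := Ideal.Quotient.eq_zero_iff_mem.2 hmem
      rw [map_sub, sub_eq_zero, map_mul, map_pow, map_neg, map_one, esymm_root] at h
      exact h

theorem exists_lift {S : Type*} [CommRing S] [Algebra A S] (β : Fin f.natDegree → S)
    (hβ : f.map (algebraMap A S) = ∏ i, (X - C (β i))) :
    ∃ φ : SplittingRing f →ₐ[A] S, ∀ i, φ (root f i) = β i := by
  refine ⟨Ideal.Quotient.liftₐ _ (MvPolynomial.aeval β) fun a ha => ?_, fun i => ?_⟩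
  swap
  · exact (Ideal.Quotient.lift_mk _ _ _).trans (MvPolynomial.aeval_X β i)
  have hle : splittingIdeal f ≤ RingHom.ker (MvPolynomial.aeval (R := A) β) := by
    refine Ideal.span_le.2 ?_
    rintro _ ⟨i, -, hi, rfl⟩
    rw [SetLike.mem_coe, RingHom.mem_ker, map_sub, map_mul, map_pow, map_neg, map_one,
      MvPolynomial.aeval_C, MvPolynomial.aeval_esymm_eq_multiset_esymm, ← coeff_prod_X_sub_C β hi,
      ← hβ, coeff_map, sub_self]
  exact hle ha

theorem isSplittingAlgebra (hf : f.Monic) : IsSplittingAlgebra f (root f) where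
  map_eq := map_eq_prod hf
  adjoin_eq_top := adjoin_root f
  exists_lift _ _ _ α hα := exists_lift α hα

/-- The universal properties give maps to and from the flat algebra T that match the roots, so the
splitting ring is a retract of T. -/
theorem flat (hf : f.Monic) : Module.Flat A (SplittingRing f) := by
  obtain ⟨T, _, _, η, hT, hη, hlift⟩ := exists_flat_universal_splitting hf rfl
  obtain ⟨i, hi⟩ := exists_lift η hη
  obtain ⟨r, hr⟩ := hlift (SplittingRing f) (root f) (map_eq_prod hf)
  have h : r.comp i = AlgHom.id A _ := by
    refine AlgHom.ext_of_adjoin_eq_top (adjoin_root f) ?_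
    rintro _ ⟨j, rfl⟩
    simp [hi, hr]
  exact Module.Flat.of_retract i.toLinearMap r.toLinearMap
    (LinearMap.ext fun x => DFunLike.congr_fun h x)

end SplittingRing

/-- Splitting algebras are stable under base change. -/
theorem IsSplittingAlgebra.baseChange {A B A' : Type u} [CommRing A] [CommRing B] [Algebra A B]
    {f : A[X]} {n : ℕ} {ξ : Fin n → B} (h : IsSplittingAlgebra f ξ) [CommRing A'] [Algebra A A'] :
    IsSplittingAlgebra (B := A' ⊗[A] B) (f.map (algebraMap A A')) (fun i => 1 ⊗ₜ[A] ξ i) where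
  map_eq := by
    rw [Polynomial.map_map, ← IsScalarTower.algebraMap_eq,
      ← (Algebra.TensorProduct.includeRight : B →ₐ[A] A' ⊗[A] B).comp_algebraMap,
      ← Polynomial.map_map, h.map_eq, Polynomial.map_prod]
    simp
  adjoin_eq_top := by
    refine Algebra.eq_top_iff.2 fun x => ?_
    have hle : Algebra.adjoin A (Set.range ξ) ≤
        ((Algebra.adjoin A' (Set.range fun i => (1 : A') ⊗ₜ[A] ξ i)).restrictScalars A).comap
          Algebra.TensorProduct.includeRight := by
      refine Algebra.adjoin_le ?_
      rintro _ ⟨i, rfl⟩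
      exact Algebra.subset_adjoin ⟨i, rfl⟩
    rw [h.adjoin_eq_top] at hle
    induction x with
    | zero => exact zero_mem _
    | add x y hx hy => exact add_mem hx hy
    | tmul a b =>
      have hb : (1 : A') ⊗ₜ[A] b ∈ Algebra.adjoin A' (Set.range fun i => (1 : A') ⊗ₜ[A] ξ i) :=
        hle (Algebra.mem_top (x := b))
      simpa [TensorProduct.smul_tmul'] using Subalgebra.smul_mem _ hb a
  exists_lift L _ _ α hα := by
    let _ : Algebra A L := Algebra.compHom L (algebraMap A A')
    have _ : IsScalarTower A A' L := IsScalarTower.of_algebraMap_eq' rfl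
    obtain ⟨φ, hφ⟩ := h.exists_lift L α (by
      rw [IsScalarTower.algebraMap_eq A A' L, ← Polynomial.map_map, hα])
    exact ⟨Algebra.TensorProduct.lift (Algebra.ofId A' L) φ fun _ _ => Commute.all _ _, fun i => by
      simp [hφ]⟩

/-! ### Orderings of the roots and interpolation -/

theorem exists_perm_of_prod_X_sub_C_eq {L : Type*} [Field L] {n : ℕ} {α β : Fin n → L}
    (h : ∏ i, (X - C (α i)) = ∏ i, (X - C (β i))) (hβ : Function.Injective β) :
    ∃ σ : Equiv.Perm (Fin n), ∀ i, α i = β (σ i) := by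
  have hα : Function.Injective α := by
    rw [← separable_prod_X_sub_C_iff, h]
    exact separable_prod_X_sub_C_iff.2 hβ
  have hroot (i : Fin n) : ∃ j, α i = β j := by
    have : (∏ i, (X - C (β i))).eval (α i) = 0 := by
      rw [← h, eval_prod]
      exact Finset.prod_eq_zero (Finset.mem_univ i) (by simp)
    rw [eval_prod, Finset.prod_eq_zero_iff] at this
    obtain ⟨j, -, hj⟩ := this
    exact ⟨j, sub_eq_zero.1 (by simpa using hj)⟩
  choose σ hσ using hroot
  have hinj : Function.Injective σ := fun i j hij => hα (by rw [hσ, hσ, hij])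
  exact ⟨Equiv.ofBijective σ (Finite.injective_iff_bijective.1 hinj), hσ⟩

theorem Polynomial.Splits.exists_eq_prod_X_sub_C {L : Type*} [Field L] {f : L[X]} {n : ℕ}
    (hf : f.Monic) (hs : f.Splits) (hn : f.natDegree = n) :
    ∃ α : Fin n → L, f = ∏ i, (X - C (α i)) := by
  have hprod := hs.eq_prod_roots_of_monic hf
  have hcard : Multiset.card f.roots = n := by rw [← hs.natDegree_eq_card_roots, hn]
  obtain ⟨l, hl⟩ := Quot.exists_rep f.roots
  have hl' : (l : Multiset L) = f.roots := hl
  rw [← hl'] at hprod hcard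
  obtain rfl : l.length = n := by simpa using hcard
  refine ⟨fun i => l[i], ?_⟩
  rw [hprod]
  rw [Multiset.map_coe, Multiset.prod_coe]
  exact (Fin.prod_univ_fun_getElem l fun a => X - C a).symm

theorem Equiv.Perm.eq_one_of_apply_le {n : ℕ} {ρ : Equiv.Perm (Fin n)} (h : ∀ i, ρ i ≤ i) :
    ρ = 1 := by
  ext i
  induction i using WellFoundedLT.induction with
  | ind i ih =>
    rcases (h i).lt_or_eq with hlt | heq
    · have := ρ.injective (Fin.ext (ih _ hlt) : ρ (ρ i) = ρ i)
      exact absurd this hlt.ne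
    · simp [heq]

/-- The kernel `∏ i < j, (y j - x i)`, as a polynomial in `y` with coefficients polynomials
in `x`. -/
noncomputable def interpolationKernel (n : ℕ) : MvPolynomial (Fin n) (MvPolynomial (Fin n) ℤ) :=
  ∏ i, ∏ j ∈ Finset.Ioi i, (MvPolynomial.X j - MvPolynomial.C (MvPolynomial.X i))

theorem det_vandermonde_comp_perm {S : Type*} [CommRing S] {n : ℕ} (α : Fin n → S)
    (σ : Equiv.Perm (Fin n)) : (Matrix.vandermonde fun i => α (σ i)).det =
      ((Equiv.Perm.sign σ : ℤ) : S) * (Matrix.vandermonde α).det :=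
  Matrix.det_permute σ (Matrix.vandermonde α)

/-- Expanding in y separates the variables: the x-part can be absorbed into alternating sums, the
y-part consists of monomials in the roots. -/
theorem sum_aeval_coeff_interpolationKernel {S : Type*} [CommRing S] {n : ℕ} (x y : Fin n → S) :
    ∑ m ∈ (interpolationKernel n).support,
      MvPolynomial.aeval x ((interpolationKernel n).coeff m) * ∏ i, y i ^ m i =
    ∏ i, ∏ j ∈ Finset.Ioi i, (y j - x i) := by
  have h := MvPolynomial.eval₂_eq' (MvPolynomial.aeval (R := ℤ) x).toRingHom y
    (interpolationKernel n)
  refine h.symm.trans ?_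
  rw [← MvPolynomial.coe_eval₂Hom, interpolationKernel]
  simp only [map_prod, map_sub, MvPolynomial.coe_eval₂Hom, MvPolynomial.eval₂_X,
    MvPolynomial.eval₂_C]
  simp

/-- A function on the orderings of `α` is interpolated by an explicit polynomial whose
coefficients are alternating sums. -/
theorem sum_interpolationKernel {S : Type*} [CommRing S] {n : ℕ} (α : Fin n → S)
    (b : Equiv.Perm (Fin n) → S) (τ : Equiv.Perm (Fin n)) :
    ∑ m ∈ (interpolationKernel n).support,
      (∑ σ : Equiv.Perm (Fin n), ((Equiv.Perm.sign σ : ℤ) : S) * (b σ *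
        MvPolynomial.aeval (fun i => α (σ i)) ((interpolationKernel n).coeff m))) *
        ∏ i, α (τ i) ^ m i = b τ * (Matrix.vandermonde α).det := by
  simp_rw [Finset.sum_mul]
  rw [Finset.sum_comm, Finset.sum_eq_single τ]
  -- On the diagonal σ = τ the kernel is the Vandermonde determinant of the permuted roots, and the
  -- two signs cancel.
  · simp_rw [mul_assoc]
    rw [← Finset.mul_sum, ← Finset.mul_sum, sum_aeval_coeff_interpolationKernel,
      ← Matrix.det_vandermonde (fun i => α (τ i)), det_vandermonde_comp_perm]
    rw [mul_left_comm (b τ), ← mul_assoc, ← Int.cast_mul, ← Units.val_mul, Int.units_mul_self]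
    simp
  · intro σ _ hσ
    simp_rw [mul_assoc]
    rw [← Finset.mul_sum, ← Finset.mul_sum, sum_aeval_coeff_interpolationKernel]
    -- Such a pair gives a zero factor of the kernel. Without one, τ⁻¹σ never increases an index, so
    -- σ = τ.
    suffices h : ∃ i j, i < j ∧ σ i = τ j by
      obtain ⟨i, j, hij, h⟩ := h
      rw [Finset.prod_eq_zero (Finset.mem_univ i)
        (Finset.prod_eq_zero (Finset.mem_Ioi.2 hij) (by rw [h, sub_self])), mul_zero, mul_zero]
    by_contra! hne
    refine hσ (inv_mul_eq_one.1 (Equiv.Perm.eq_one_of_apply_le (ρ := τ⁻¹ * σ) fun i => ?_)).symm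
    by_contra! hlt
    exact hne i _ hlt (by simp)
  · simp

/-! ### Splitting algebras and their generic fibre -/

namespace IsSplittingAlgebra

section Field

variable {K B : Type u} [Field K] [CommRing B] [Algebra K B] {f : K[X]} {n : ℕ} {ξ : Fin n → B}

theorem aeval_eq_zero {A B : Type u} [CommRing A] [CommRing B] [Algebra A B] {f : A[X]}
    {ξ : Fin n → B} (h : IsSplittingAlgebra f ξ) (i : Fin n) : aeval (ξ i) f = 0 := by
  rw [aeval_def, ← eval_map, h.map_eq, eval_prod]
  exact Finset.prod_eq_zero (Finset.mem_univ i) (by simp)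

theorem isIntegral_apply {A B : Type u} [CommRing A] [CommRing B] [Algebra A B] {f : A[X]}
    {ξ : Fin n → B} (h : IsSplittingAlgebra f ξ) (hf : f.Monic) (i : Fin n) :
    IsIntegral A (ξ i) :=
  ⟨f, hf, h.aeval_eq_zero i⟩

theorem finite {A B : Type u} [CommRing A] [CommRing B] [Algebra A B] {f : A[X]}
    {ξ : Fin n → B} (h : IsSplittingAlgebra f ξ) (hf : f.Monic) : Module.Finite A B := by
  have := (Set.finite_range ξ)
  refine ⟨?_⟩
  rw [← Algebra.top_toSubmodule, ← h.adjoin_eq_top]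
  refine fg_adjoin_of_finite this ?_
  rintro _ ⟨i, rfl⟩
  exact h.isIntegral_apply hf i

/-- The differentials are generated by the dξ_i, which vanish because f'(ξ_i) dξ_i = d(f(ξ_i)) = 0
and f'(ξ_i) is a unit by separability. -/
theorem formallyUnramified (h : IsSplittingAlgebra f ξ) (hsep : f.Separable) :
    Algebra.FormallyUnramified K B := by
  have hD : (KaehlerDifferential.D K B) = 0 := by
    refine Derivation.ext_of_adjoin_eq_top _ h.adjoin_eq_top ?_
    rintro _ ⟨i, rfl⟩
    obtain ⟨a, b, hab⟩ := hsep
    have h1 := congrArg (aeval (ξ i)) hab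
    rw [map_add, map_mul, map_mul, h.aeval_eq_zero, mul_zero, zero_add, map_one] at h1
    have h2 := (KaehlerDifferential.D K B).map_aeval f (ξ i)
    rw [h.aeval_eq_zero, map_zero] at h2
    rw [Derivation.zero_apply, ← one_smul B (KaehlerDifferential.D K B (ξ i)), ← h1, mul_smul,
      ← h2, smul_zero]
  rw [Algebra.formallyUnramified_iff]
  refine ⟨fun x y => (Submodule.subsingleton_iff B).1 ?_ |>.elim x y⟩
  refine subsingleton_of_bot_eq_top ?_
  rw [← KaehlerDifferential.span_range_derivation, hD, eq_comm, Submodule.span_eq_bot]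
  rintro _ ⟨b, rfl⟩
  rfl

theorem isReduced (h : IsSplittingAlgebra f ξ) (hf : f.Monic) (hsep : f.Separable) :
    IsReduced B := by
  have := h.finite hf
  have := h.formallyUnramified hsep
  exact Algebra.FormallyUnramified.isReduced_of_field K B

/-- The points of a splitting algebra of a separable polynomial given by the orderings of the
roots in a splitting field are jointly injective. -/
theorem eq_zero_of_forall_apply_eq_zero (h : IsSplittingAlgebra f ξ) (hf : f.Monic)
    (hsep : f.Separable) {L : Type u} [Field L] [Algebra K L] [f.IsSplittingField K L]
    {α : Fin n → L} (hα : f.map (algebraMap K L) = ∏ i, (X - C (α i)))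
    {φ : Equiv.Perm (Fin n) → B →ₐ[K] L} (hφ : ∀ σ i, φ σ (ξ i) = α (σ i)) {x : B}
    (hx : ∀ σ, φ σ x = 0) : x = 0 := by
  have := h.isReduced hf hsep
  have := h.finite hf
  -- Every residue field B/P receives L, and there the images of the ξ_i are a reordering of the
  -- α_i. So B → B/P factors through some φ_σ, and x lies in every prime.
  refine IsReduced.eq_zero x (nilpotent_iff_mem_prime.2 fun P hP => ?_)
  let _ : Field (B ⧸ P) := (isField_of_isIntegral_of_isField' (R := K) (Field.toIsField K)).toField
  have hE : f.map (algebraMap K (B ⧸ P)) = ∏ i, (X - C (Ideal.Quotient.mk P (ξ i))) := by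
    rw [IsScalarTower.algebraMap_eq K B (B ⧸ P), ← Polynomial.map_map, h.map_eq,
      Polynomial.map_prod]
    simp
  have hs : (f.map (algebraMap K (B ⧸ P))).Splits := by
    rw [hE]
    exact Splits.prod fun i _ => Splits.X_sub_C _
  let ψ : L →ₐ[K] B ⧸ P := IsSplittingField.lift L f hs
  have hψ : f.map (algebraMap K (B ⧸ P)) = ∏ i, (X - C (ψ (α i))) := by
    rw [← ψ.comp_algebraMap, ← Polynomial.map_map, hα, Polynomial.map_prod]
    simp
  have hinj : Function.Injective α := by
    rw [← separable_prod_X_sub_C_iff, ← hα]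
    exact hsep.map
  obtain ⟨σ, hσ⟩ := exists_perm_of_prod_X_sub_C_eq (hE.symm.trans hψ) (ψ.injective.comp hinj)
  have hcomp : ψ.comp (φ σ) = Ideal.Quotient.mkₐ K P := by
    refine AlgHom.ext_of_adjoin_eq_top h.adjoin_eq_top ?_
    rintro _ ⟨i, rfl⟩
    simp [hφ, hσ]
  have := DFunLike.congr_fun hcomp x
  rw [AlgHom.comp_apply, hx, map_zero] at this
  exact Ideal.Quotient.eq_zero_iff_mem.1 this.symm

/-- The quotient of an alternating sum by the Vandermonde determinant is rational. -/
theorem exists_algebraMap_mul_det_eq (h : IsSplittingAlgebra f ξ) (hsep : f.Separable)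
    {L : Type u} [Field L] [Algebra K L] [f.IsSplittingField K L]
    {α : Fin n → L} (hα : f.map (algebraMap K L) = ∏ i, (X - C (α i)))
    {φ : Equiv.Perm (Fin n) → B →ₐ[K] L} (hφ : ∀ σ i, φ σ (ξ i) = α (σ i)) (x : B) :
    ∃ t : K, algebraMap K L t * (Matrix.vandermonde α).det =
      ∑ σ : Equiv.Perm (Fin n), ((Equiv.Perm.sign σ : ℤ) : L) * φ σ x := by
  have hgal : IsGalois K L := IsGalois.of_separable_splitting_field hsep
  have hfd : FiniteDimensional K L := IsSplittingField.finiteDimensional L f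
  have hinj : Function.Injective α := by
    rw [← separable_prod_X_sub_C_iff, ← hα]
    exact hsep.map
  have hδ : (Matrix.vandermonde α).det ≠ 0 := Matrix.det_vandermonde_ne_zero_iff.2 hinj
  set δ := (Matrix.vandermonde α).det with hδdef
  set N := ∑ σ : Equiv.Perm (Fin n), ((Equiv.Perm.sign σ : ℤ) : L) * φ σ x with hN
  -- Numerator and δ both change by the sign of the permutation that τ induces on the roots, so the
  -- quotient is Galois invariant.
  suffices hfix : ∀ τ : L ≃ₐ[K] L, τ (N / δ) = N / δ by
    obtain ⟨t, ht⟩ := IntermediateField.mem_bot.1 ((IsGalois.mem_bot_iff_fixed _).2 hfix)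
    exact ⟨t, by rw [ht, div_mul_cancel₀ _ hδ]⟩
  intro τ
  have hτ : ∏ i, (X - C (τ (α i))) = ∏ i, (X - C (α i)) := by
    rw [← hα]
    conv_rhs => rw [← τ.toAlgHom.comp_algebraMap, ← Polynomial.map_map, hα, Polynomial.map_prod]
    simp
  obtain ⟨π, hπ⟩ := exists_perm_of_prod_X_sub_C_eq hτ hinj
  have hτδ : τ δ = ((Equiv.Perm.sign π : ℤ) : L) * δ := by
    rw [hδdef, ← det_vandermonde_comp_perm, ← AlgEquiv.coe_ringEquiv, RingEquiv.map_det]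
    congr 1
    ext i j
    simp [Matrix.vandermonde, hπ]
  have hcomp (σ : Equiv.Perm (Fin n)) : τ.toAlgHom.comp (φ σ) = φ (π * σ) := by
    refine AlgHom.ext_of_adjoin_eq_top h.adjoin_eq_top ?_
    rintro _ ⟨i, rfl⟩
    simp [hφ, hπ]
  have hsq : ((Equiv.Perm.sign π : ℤ) : L) * ((Equiv.Perm.sign π : ℤ) : L) = 1 := by
    rw [← Int.cast_mul, ← Units.val_mul, Int.units_mul_self]
    simp
  have hτN : τ N = ((Equiv.Perm.sign π : ℤ) : L) * N := by
    rw [hN, map_sum, Finset.mul_sum]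
    refine Fintype.sum_equiv (Equiv.mulLeft π) _ _ fun σ => ?_
    have : τ (φ σ x) = φ (π * σ) x := DFunLike.congr_fun (hcomp σ) x
    rw [map_mul, map_intCast, this, Equiv.coe_mulLeft, map_mul, Units.val_mul, Int.cast_mul,
      ← mul_assoc, ← mul_assoc, hsq, one_mul]
  rw [map_div₀, hτN, hτδ, mul_div_mul_left _ _ (left_ne_zero_of_mul_eq_one hsq)]

end Field

end IsSplittingAlgebra

/-! ### Integral closedness and normality -/

/-- Stabilization of the powers of y makes y²z - y nilpotent, hence zero. Then yz is the idempotent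
supporting y. -/
theorem exists_mul_mul_eq_self {S : Type*} [CommRing S] [IsArtinianRing S] [IsReduced S] (y : S) :
    ∃ z, y * y * z = y := by
  obtain ⟨n, z, hz⟩ := IsArtinian.exists_pow_succ_smul_dvd y (1 : S)
  refine ⟨z, sub_eq_zero.1 (IsReduced.eq_zero _ ⟨n + 1, ?_⟩)⟩
  simp only [smul_eq_mul, mul_one, Nat.succ_eq_add_one] at hz
  have h : y ^ n * (y * y * z - y) = 0 := by linear_combination y * hz
  calc (y * y * z - y) ^ (n + 1) = (y * z - 1) ^ n * (y ^ n * (y * y * z - y)) := by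
        rw [pow_succ, show y * y * z - y = y * (y * z - 1) by ring, mul_pow]
        ring
    _ = 0 := by rw [h, mul_zero]

/-- A multiple `e * w` by an idempotent satisfies an integral equation once `w` satisfies one
after multiplication by `e`. -/
theorem isIntegral_idempotent_mul {B S : Type*} [CommRing B] [CommRing S] [Algebra B S] {e w : S}
    (he : e * e = e) {g : B[X]} (hg : g.Monic) (h : e * aeval w g = 0) : IsIntegral B (e * w) := by
  -- The extra factor X supplies the e needed to replace g(ew) by g(w).
  refine ⟨X * g, monic_X.mul hg, ?_⟩
  rw [← aeval_def, map_mul, aeval_X]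
  obtain ⟨c, hc⟩ := (g.map (algebraMap B S)).sub_dvd_eval_sub (e * w) w
  rw [eval_map_algebraMap, eval_map_algebraMap] at hc
  linear_combination w * h + w * e * hc + w * w * c * he

namespace IsSplittingAlgebra

variable {R K B : Type u} [CommRing R] [Field K] [Algebra R K]
  [IsFractionRing R K] [CommRing B] [Algebra R B] {f : R[X]} {n : ℕ} {ξ : Fin n → B}

theorem separable_map (hf : f.Monic) (hΔ : f.discr ≠ 0) : (f.map (algebraMap R K)).Separable := by
  let g := f.map (algebraMap R K)
  obtain ⟨α, hα⟩ := (SplittingField.splits g).exists_eq_prod_X_sub_C ((hf.map _).map _) rfl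
  rw [← Polynomial.separable_map (algebraMap K g.SplittingField), hα, separable_prod_X_sub_C_iff,
    ← Matrix.det_vandermonde_ne_zero_iff]
  intro h0
  have h1 := discr_prod_X_sub_C α
  rw [← hα, h0, Polynomial.map_map, hf.discr_map, zero_pow two_ne_zero, RingHom.comp_apply,
    map_eq_zero, map_eq_zero_iff _ (IsFractionRing.injective R K)] at h1
  exact hΔ h1

/-- If the discriminant is nonzero and squarefree, the splitting algebra is integrally closed in
its generic fibre. -/
theorem exists_one_tmul_eq_of_isIntegral (h : IsSplittingAlgebra f ξ) (hf : f.Monic)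
    (hn : f.natDegree = n) (hΔ : f.discr ≠ 0)
    (hsq : ∀ t : K, IsIntegral R (algebraMap R K f.discr * t ^ 2) → ∃ r, algebraMap R K r = t)
    {L : Type u} [Field L] [Algebra K L] [Algebra R L] [IsScalarTower R K L]
    [(f.map (algebraMap R K)).IsSplittingField K L] {b : K ⊗[R] B} (hb : IsIntegral R b) :
    ∃ b' : B, (1 : K) ⊗ₜ[R] b' = b := by
  have hK : IsSplittingAlgebra (f.map (algebraMap R K)) fun i => (1 : K) ⊗ₜ[R] ξ i := h.baseChange
  have hsep : (f.map (algebraMap R K)).Separable := separable_map hf hΔ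
  have hfK : (f.map (algebraMap R K)).Monic := hf.map _
  obtain ⟨α, hα⟩ := (IsSplittingField.splits L (f.map (algebraMap R K))).exists_eq_prod_X_sub_C
    (hfK.map _) (by rw [hfK.natDegree_map, hf.natDegree_map, hn])
  have hσ (σ : Equiv.Perm (Fin n)) : ∃ φ : K ⊗[R] B →ₐ[K] L,
      ∀ i, φ ((1 : K) ⊗ₜ[R] ξ i) = α (σ i) :=
    hK.exists_lift L (fun i => α (σ i)) (by
      rw [hα, Equiv.prod_comp σ fun i => X - C (α i)])
  choose φ hφ using hσ
  set δ := (Matrix.vandermonde α).det with hδdef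
  have hδ2 : algebraMap R L f.discr = δ ^ 2 := by
    have : Polynomial.map (algebraMap R L) f = ∏ i, (X - C (α i)) := by
      rw [← hα, Polynomial.map_map, ← IsScalarTower.algebraMap_eq]
    rw [← hf.discr_map, this, discr_prod_X_sub_C]
  have hδ : δ ≠ 0 := by
    rw [Matrix.det_vandermonde_ne_zero_iff, ← separable_prod_X_sub_C_iff, ← hα]
    exact hsep.map
  have key (x : K ⊗[R] B) (hx : IsIntegral R x) : ∃ r : R, algebraMap R L r * δ =
      ∑ σ : Equiv.Perm (Fin n), ((Equiv.Perm.sign σ : ℤ) : L) * φ σ x := by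
    obtain ⟨t, ht⟩ := hK.exists_algebraMap_mul_det_eq hsep hα hφ x
    have hint : IsIntegral R (∑ σ : Equiv.Perm (Fin n), ((Equiv.Perm.sign σ : ℤ) : L) * φ σ x) :=
      IsIntegral.sum _ fun σ _ => (isIntegral_intCast ..).mul
        (hx.map ((φ σ).restrictScalars R))
    obtain ⟨r, hr⟩ := hsq t (by
      refine (isIntegral_algebraMap_iff (algebraMap K L).injective).1 ?_
      rw [map_mul, map_pow, ← IsScalarTower.algebraMap_apply, hδ2, mul_comm, ← mul_pow, ht]
      exact hint.pow 2)
    exact ⟨r, by rw [IsScalarTower.algebraMap_apply R K L, hr, ht]⟩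
  have hcoef (c : MvPolynomial (Fin n) ℤ) :
      IsIntegral R ((1 : K) ⊗ₜ[R] MvPolynomial.aeval ξ c) := by
    have := h.finite hf
    exact (Algebra.IsIntegral.isIntegral (R := R) (MvPolynomial.aeval ξ c)).map
      (Algebra.TensorProduct.includeRight : B →ₐ[R] K ⊗[R] B)
  have hval (σ : Equiv.Perm (Fin n)) (c : MvPolynomial (Fin n) ℤ) :
      φ σ ((1 : K) ⊗ₜ[R] MvPolynomial.aeval ξ c) =
        MvPolynomial.aeval (fun i => α (σ i)) c := by
    have : (((φ σ).toRingHom.comp (Algebra.TensorProduct.includeRight :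
        B →ₐ[R] K ⊗[R] B).toRingHom).comp (MvPolynomial.aeval (R := ℤ) ξ).toRingHom) =
        (MvPolynomial.aeval (R := ℤ) fun i => α (σ i)).toRingHom := by
      refine MvPolynomial.ringHom_ext (fun r => ?_) fun i => ?_
      · simp
      · simp [hφ]
    exact DFunLike.congr_fun this c
  -- Multiplying b by the kernel's coefficients, evaluated at ξ, keeps it integral; the resulting r
  -- m are the coefficients of b in the monomials of ξ.
  have key' (m : Fin n →₀ ℕ) := key _ (hb.mul (hcoef ((interpolationKernel n).coeff m)))
  choose r hr using key'
  refine ⟨∑ m ∈ (interpolationKernel n).support, r m • ∏ i, ξ i ^ m i, ?_⟩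
  refine sub_eq_zero.1 (hK.eq_zero_of_forall_apply_eq_zero hfK hsep hα hφ fun τ => ?_)
  rw [map_sub, sub_eq_zero]
  refine mul_right_cancel₀ hδ ?_
  rw [← sum_interpolationKernel α (fun σ => φ σ b) τ, TensorProduct.tmul_sum, map_sum,
    Finset.sum_mul]
  refine Finset.sum_congr rfl fun m _ => ?_
  have hmon : φ τ ((1 : K) ⊗ₜ[R] ∏ i, ξ i ^ m i) = ∏ i, α (τ i) ^ m i := by
    have := hval τ (∏ i, MvPolynomial.X i ^ m i)
    simpa using this
  have hsum := hr m
  simp_rw [map_mul, hval] at hsum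
  rw [← hsum, TensorProduct.tmul_smul, ← algebraMap_smul K, map_smul, hmon,
    Algebra.smul_def, ← IsScalarTower.algebraMap_apply]
  ring

attribute [local instance] Algebra.TensorProduct.rightAlgebra

theorem isNormalRing (h : IsSplittingAlgebra f ξ) [Module.Flat R B] (hf : f.Monic)
    (hn : f.natDegree = n) (hΔ : f.discr ≠ 0)
    (hsq : ∀ t : K, IsIntegral R (algebraMap R K f.discr * t ^ 2) → ∃ r, algebraMap R K r = t) :
    IsNormalRing B := by
  have hfin := h.finite hf
  have hred : IsReduced (K ⊗[R] B) := h.baseChange.isReduced (hf.map _) (separable_map hf hΔ)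
  have hart : IsArtinianRing (K ⊗[R] B) := IsArtinianRing.of_finite K _
  obtain ⟨ι, hι⟩ : ∃ ι : B →ₐ[R] K ⊗[R] B, ι = Algebra.TensorProduct.includeRight := ⟨_, rfl⟩
  have hinj : Function.Injective ι := by
    rw [hι]
    exact Algebra.TensorProduct.includeRight_injective (IsFractionRing.injective R K)
  have hιalg : ι.toRingHom = algebraMap B (K ⊗[R] B) := by rw [hι]; rfl
  have hmem {b : K ⊗[R] B} (hb : IsIntegral B b) : ∃ b' : B, ι b' = b := by
    rw [hι]
    exact h.exists_one_tmul_eq_of_isIntegral hf hn hΔ hsq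
      (L := (f.map (algebraMap R K)).SplittingField) (isIntegral_trans b hb)
  have hidem (y : K ⊗[R] B) : ∃ (z : K ⊗[R] B) (e : B), y * y * z = y ∧ ι e = y * z := by
    obtain ⟨z, hz⟩ := exists_mul_mul_eq_self y
    have hyz : y * z * (y * z) = y * z := by linear_combination z * hz
    obtain ⟨e, he⟩ := hmem (b := y * z) ⟨X ^ 2 - X, by monicity!, by simp [sq, hyz]⟩
    exact ⟨z, e, hz, he⟩
  have hreg {r : R} (hr : r ≠ 0) {c : B} (hc : r • c = 0) : c = 0 := by
    refine hinj ?_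
    have h1 := congrArg ι hc
    rw [map_smul, map_zero, ← algebraMap_smul K] at h1
    rw [map_zero]
    refine (smul_eq_zero_iff_right ?_).1 h1
    rwa [Ne, map_eq_zero_iff _ (IsFractionRing.injective R K)]
  intro q hq
  have hdom : IsDomain (Localization.AtPrime q) := by
    have : NoZeroDivisors (Localization.AtPrime q) := by
      refine ⟨fun {x' y'} hxy => ?_⟩
      obtain ⟨x, s, rfl⟩ := IsLocalization.exists_mk'_eq q.primeCompl x'
      obtain ⟨y, t, rfl⟩ := IsLocalization.exists_mk'_eq q.primeCompl y'
      rw [← IsLocalization.mk'_mul, IsLocalization.mk'_eq_zero_iff] at hxy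
      obtain ⟨c, hc⟩ := hxy
      -- The idempotent e supports cx, so 1 - e kills cx and e kills y; at least one of e, 1 - e
      -- lies outside q.
      obtain ⟨z, e, hz, he⟩ := hidem (ι (c * x))
      have h1 : (1 - e) * (c * x) = 0 := by
        refine hinj ?_
        rw [map_mul, map_sub, he, map_one, map_zero]
        linear_combination -hz
      have h2 : e * y = 0 := by
        refine hinj ?_
        have := congrArg ι hc
        rw [← mul_assoc, map_mul, map_zero] at this
        rw [map_mul, he, map_zero]
        linear_combination z * this
      by_cases heq : e ∈ q
      · left
        rw [IsLocalization.mk'_eq_zero_iff]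
        have h1e : 1 - e ∈ q.primeCompl := fun hmem' =>
          hq.ne_top ((Ideal.eq_top_iff_one _).2 (by simpa using add_mem hmem' heq))
        exact ⟨⟨1 - e, h1e⟩ * c, by simpa [mul_assoc] using h1⟩
      · right
        rw [IsLocalization.mk'_eq_zero_iff]
        exact ⟨⟨e, heq⟩, h2⟩
    exact NoZeroDivisors.to_isDomain _
  refine ⟨hdom, (isIntegrallyClosed_iff (FractionRing (Localization.AtPrime q))).2 fun {a} ha => ?_⟩
  let F := FractionRing (Localization.AtPrime q)
  have hRF : Function.Injective (algebraMap R F) := by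
    rw [IsScalarTower.algebraMap_eq R (Localization.AtPrime q) F]
    refine (IsFractionRing.injective (Localization.AtPrime q) F).comp ?_
    refine (injective_iff_map_eq_zero (algebraMap R (Localization.AtPrime q))).2 fun r hr => ?_
    by_contra hr0
    rw [IsScalarTower.algebraMap_apply R B, IsLocalization.map_eq_zero_iff q.primeCompl] at hr
    obtain ⟨c, hc⟩ := hr
    have hc0 : (c : B) = 0 := hreg hr0 (by rw [Algebra.smul_def, mul_comm, hc])
    exact c.2 (hc0 ▸ q.zero_mem)
  let j : K ⊗[R] B →ₐ[R] F := Algebra.TensorProduct.lift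
    (IsFractionRing.liftAlgHom (g := Algebra.ofId R F) hRF) (IsScalarTower.toAlgHom R B F)
    fun _ _ => Commute.all _ _
  have hj (b : B) : j (ι b) = algebraMap B F b := by
    rw [hι, Algebra.TensorProduct.includeRight_apply, Algebra.TensorProduct.lift_tmul, map_one,
      one_mul]
    rfl
  obtain ⟨s, g, hg, hgs⟩ := ha.exists_multiple_integral_of_isLocalization q.primeCompl
  obtain ⟨x', y', hy', rfl⟩ := IsFractionRing.div_surjective (A := Localization.AtPrime q) a
  obtain ⟨x, s₁, rfl⟩ := IsLocalization.exists_mk'_eq q.primeCompl x'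
  obtain ⟨y, s₂, rfl⟩ := IsLocalization.exists_mk'_eq q.primeCompl y'
  set a : F := algebraMap _ F (IsLocalization.mk' (Localization.AtPrime q) x s₁) /
    algebraMap _ F (IsLocalization.mk' (Localization.AtPrime q) y s₂) with hadef
  have hne (t : q.primeCompl) : algebraMap B F t ≠ 0 := by
    rw [IsScalarTower.algebraMap_apply B (Localization.AtPrime q) F]
    exact ((IsLocalization.map_units (Localization.AtPrime q) t).map _).ne_zero
  have hmk (b : B) (t : q.primeCompl) :
      algebraMap _ F (IsLocalization.mk' (Localization.AtPrime q) b t) * algebraMap B F t =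
        algebraMap B F b := by
    rw [IsScalarTower.algebraMap_apply B (Localization.AtPrime q) F, ← map_mul,
      IsLocalization.mk'_spec, ← IsScalarTower.algebraMap_apply]
  have hy : algebraMap _ F (IsLocalization.mk' (Localization.AtPrime q) y s₂) ≠ 0 := by
    rw [Ne, map_eq_zero_iff _ (IsFractionRing.injective (Localization.AtPrime q) F)]
    exact nonZeroDivisors.ne_zero hy'
  have hay := div_mul_cancel₀ (algebraMap _ F (IsLocalization.mk' (Localization.AtPrime q) x s₁)) hy
  rw [← hadef] at hay
  -- The quasi-inverse z becomes a true inverse in F. Thus sa, for the fraction a = xs₂/(ys₁), lifts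
  -- to w in K ⊗ B.
  obtain ⟨z, -, hz, -⟩ := hidem (ι (y * s₁))
  have hjy : j (ι (y * s₁)) ≠ 0 := by
    rw [hj, map_mul, ← hmk y s₂]
    exact mul_ne_zero (mul_ne_zero hy (hne s₂)) (hne s₁)
  have hjz : j (ι (y * s₁)) * j z = 1 := by
    have := congrArg j hz
    rw [map_mul, map_mul, mul_assoc] at this
    exact (mul_eq_left₀ hjy).1 this
  set w := ι (s * (x * s₂)) * z with hw
  have hjw : j w = (s : B) • a := by
    refine mul_right_cancel₀ hjy ?_
    rw [hw, map_mul, mul_assoc, mul_comm (j z), hjz, mul_one, hj, hj, Algebra.smul_def, map_mul,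
      map_mul, map_mul, ← hmk x s₁, ← hmk y s₂]
    linear_combination (-(algebraMap B F s * algebraMap B F s₁ * algebraMap B F s₂)) * hay
  have hjk : j (aeval w g) = 0 := by
    have : j.toRingHom.comp (algebraMap B (K ⊗[R] B)) = algebraMap B F := by
      rw [← hιalg]
      exact RingHom.ext hj
    have h1 : j (aeval w g) = eval₂ (j.toRingHom.comp (algebraMap B (K ⊗[R] B))) (j w) g :=
      hom_eval₂ g _ j.toRingHom w
    rw [h1, this, hjw]
    exact hgs
  -- Only the image of g(w) in F is known to vanish. Multiplying w by 1 - e, with e the support of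
  -- g(w), makes it integral over B without changing its image.
  obtain ⟨z', e, hz', he⟩ := hidem (aeval w g)
  have hje : j (ι e) = 0 := by rw [he, map_mul, hjk, zero_mul]
  have hee : ι (1 - e) * ι (1 - e) = ι (1 - e) := by
    rw [map_sub, map_one, he]
    linear_combination z' * hz'
  obtain ⟨b, hb⟩ := hmem (isIntegral_idempotent_mul hee hg (w := w) (by
    rw [map_sub, map_one, he]
    linear_combination -hz'))
  refine ⟨IsLocalization.mk' (Localization.AtPrime q) b s, mul_right_cancel₀ (hne s) ?_⟩
  rw [hmk, ← hj, hb, map_mul, map_sub, map_sub, map_one, map_one, hje, sub_zero, one_mul, hjw,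
    Algebra.smul_def, mul_comm]

end IsSplittingAlgebra

/-! ### Vanishing to order two -/

theorem IsLocalRing.map_mem_maximalIdeal_sq {R S : Type*} [CommRing R] [CommRing S] [IsLocalRing R]
    [IsLocalRing S] (f : R →+* S) [IsLocalHom f] {x : R}
    (hx : x ∈ maximalIdeal R ^ 2) : f x ∈ maximalIdeal S ^ 2 := by
  have h := Ideal.mem_map_of_mem f hx
  rw [Ideal.map_pow] at h
  exact Ideal.pow_right_mono ((((local_hom_TFAE f).out 0 2 :
    IsLocalHom f ↔ (maximalIdeal R).map f ≤ maximalIdeal S)).1 inferInstance) 2 h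

/-- The condition that `d` vanishes to order two only in codimension `≥ 2` localizes. -/
theorem HasCodimAtLeast.localization {A : Type u} [CommRing A] {d : A} {c : ℕ∞}
    (h : HasCodimAtLeast (vanishingOrderTwoLocus d) c) (M : Submonoid A) {R : Type u} [CommRing R]
    [Algebra A R] [IsLocalization M R] :
    HasCodimAtLeast (vanishingOrderTwoLocus (algebraMap A R d)) c := by
  intro P hP
  have : IsLocalization.AtPrime (Localization.AtPrime P.asIdeal)
      (P.asIdeal.comap (algebraMap A R)) :=
    IsLocalization.isLocalization_isLocalization_atPrime_isLocalization M _ _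
  let e : Localization.AtPrime P.asIdeal ≃ₐ[A]
      Localization.AtPrime (P.asIdeal.comap (algebraMap A R)) :=
    IsLocalization.algEquiv (P.asIdeal.comap (algebraMap A R)).primeCompl _ _
  have : IsLocalHom e.toRingEquiv.toRingHom := ⟨fun x hx => (isUnit_map_iff e x).1 hx⟩
  have hmem := IsLocalRing.map_mem_maximalIdeal_sq e.toRingEquiv.toRingHom hP
  have := h ⟨P.asIdeal.comap (algebraMap A R), inferInstance⟩ (by
    rw [← IsScalarTower.algebraMap_apply A R] at hmem
    simpa [vanishingOrderTwoLocus] using hmem)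
  exact this.trans (IsLocalization.height_under M P.asIdeal).le

/-- In a noetherian integrally closed domain, an element vanishing to order two only in
codimension `≥ 2` absorbs no square denominators. -/
theorem HasCodimAtLeast.exists_algebraMap_eq {R K : Type*} [CommRing R] [IsDomain R]
    [IsNoetherianRing R] [IsIntegrallyClosed R] [Field K] [Algebra R K] [IsFractionRing R K] {d : R}
    (h : HasCodimAtLeast (vanishingOrderTwoLocus d) 2) {t : K}
    (ht : IsIntegral R (algebraMap R K d * t ^ 2)) : ∃ r, algebraMap R K r = t := by
  by_contra hne
  let N : Submodule R K := LinearMap.range (Algebra.linearMap R K)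
  have hN {x : K} : x ∈ N ↔ ∃ r, algebraMap R K r = x := Iff.rfl
  let x : Submodule.span R {N.mkQ t} := ⟨N.mkQ t, Submodule.mem_span_singleton_self _⟩
  have hx : x ≠ 0 := by
    intro hx0
    have : N.mkQ t = 0 := congrArg Subtype.val hx0
    rw [Submodule.mkQ_apply, Submodule.Quotient.mk_eq_zero] at this
    exact hne (hN.1 this)
  -- An associated prime of the submodule of K/R generated by t is the ideal of denominators of some
  -- multiple t' = ct.
  obtain ⟨P, hP, -⟩ := exists_le_isAssociatedPrime_of_isNoetherianRing R x hx
  rw [isAssociatedPrime_iff] at hP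
  obtain ⟨hPprime, ⟨y, hy⟩, hPy⟩ := hP
  obtain ⟨c, rfl⟩ := Submodule.mem_span_singleton.1 hy
  set t' : K := c • t with ht'
  have hmem {a : R} : a ∈ P ↔ ∃ r, algebraMap R K r = algebraMap R K a * t' := by
    rw [hPy, Submodule.mem_colon_singleton, Submodule.mem_bot, ← Algebra.smul_def, ← hN,
      ← Submodule.Quotient.mk_eq_zero, ← Submodule.mkQ_apply, ht', map_smul, map_smul,
      ← Subtype.coe_inj]
    rfl
  have hinj := IsFractionRing.injective R K
  obtain ⟨r, hr⟩ : ∃ r, algebraMap R K r = algebraMap R K d * t' ^ 2 := by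
    refine IsIntegrallyClosed.isIntegral_iff.1 ?_
    have : algebraMap R K d * t' ^ 2 = algebraMap R K (c ^ 2) * (algebraMap R K d * t ^ 2) := by
      rw [ht', Algebra.smul_def, map_pow]
      ring
    rw [this]
    exact isIntegral_algebraMap.mul ht
  -- If Pt' ⊄ P, some s = πt' is a unit at P, so π generates P locally and P has height at most one.
  -- Then ds² = rπ² puts P in the locus, against the codimension bound.
  by_cases hcase : ∃ π ∈ P, ∃ s ∉ P, algebraMap R K s = algebraMap R K π * t'
  · obtain ⟨π, hπ, s, hs, hst⟩ := hcase
    have hprinc {a : R} (ha : a ∈ P) : ∃ b, a * s = b * π := by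
      obtain ⟨b, hb⟩ := hmem.1 ha
      refine ⟨b, hinj ?_⟩
      rw [map_mul, map_mul, hst, hb]
      ring
    have hmin : P ∈ (Ideal.span {π}).minimalPrimes := by
      refine ⟨⟨hPprime, (Ideal.span_singleton_le_iff_mem _).2 hπ⟩, fun Q hQ hQP a ha => ?_⟩
      obtain ⟨b, hb⟩ := hprinc ha
      refine (hQ.1.mem_or_mem (?_ : a * s ∈ Q)).resolve_right fun hsQ => hs (hQP hsQ)
      rw [hb]
      exact Q.mul_mem_left b ((Ideal.span_singleton_le_iff_mem _).1 hQ.2)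
    have hheight := Ideal.height_le_one_of_isPrincipal_of_mem_minimalPrimes _ P hmin
    have hd : d * s ^ 2 = r * π ^ 2 := by
      refine hinj ?_
      rw [map_mul, map_pow, hst, map_mul, map_pow, hr]
      ring
    have hloc : (⟨P, hPprime⟩ : PrimeSpectrum R) ∈ vanishingOrderTwoLocus d := by
      change algebraMap R (Localization.AtPrime P) d ∈
        IsLocalRing.maximalIdeal (Localization.AtPrime P) ^ 2
      have hu : IsUnit (algebraMap R (Localization.AtPrime P) (s ^ 2)) :=
        IsLocalization.map_units (Localization.AtPrime P)
          (⟨s, hs⟩ ^ 2 : P.primeCompl)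
      rw [← Ideal.mul_unit_mem_iff_mem _ hu, ← map_mul, hd, map_mul, map_pow]
      refine Ideal.mul_mem_left _ _ (Ideal.pow_mem_pow ?_ 2)
      exact (IsLocalization.AtPrime.to_map_mem_maximal_iff (Localization.AtPrime P) P π).2 hπ
    exact absurd ((h _ hloc).trans hheight) (by norm_num)
  · push Not at hcase
    have hPne : P ≠ ⊥ := by
      obtain ⟨a, b, hb, hab⟩ := IsFractionRing.div_surjective (A := R) t'
      have hb0 : b ≠ 0 := nonZeroDivisors.ne_zero hb
      refine fun hbot => hb0 ?_
      rw [← Ideal.mem_bot, ← hbot, hmem]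
      exact ⟨a, by rw [← hab, mul_div_cancel₀ _ (by rwa [Ne, map_eq_zero_iff _ hinj])]⟩
    -- Now Pt' ⊆ P with P nonzero and finitely generated, so t' is integral. Hence t' ∈ R and P
    -- would contain 1.
    have hint : IsIntegral R t' := by
      refine isIntegral_of_smul_mem_submodule (M := K)
        (Submodule.map (Algebra.linearMap R K) P) ?_ ((IsNoetherian.noetherian P).map _) t' ?_
      · exact fun h0 => hPne (Submodule.map_injective_of_injective (f := Algebra.linearMap R K) hinj
          (by rw [h0, Submodule.map_bot]))
      · rintro _ ⟨a, ha, rfl⟩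
        obtain ⟨s, hs⟩ := hmem.1 ha
        refine ⟨s, ?_, ?_⟩
        · by_contra hsP
          exact hcase a ha s hsP hs
        · rw [Algebra.linearMap_apply, hs, Algebra.linearMap_apply, smul_eq_mul, mul_comm]
    obtain ⟨s, hs⟩ := IsIntegrallyClosed.isIntegral_iff.1 hint
    refine hPprime.ne_top ((Ideal.eq_top_iff_one _).2 (hmem.2 ⟨s, ?_⟩))
    rw [hs, map_one, one_mul]

/-- The local ring of a noetherian normal ring at a prime of height one is a discrete valuation
ring. -/
theorem IsNormalRing.isDiscreteValuationRing {A : Type*} [CommRing A] [IsNoetherianRing A]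
    (hA : IsNormalRing A) (p : Ideal A) [p.IsPrime] (hp : p.height = 1)
    [IsDomain (Localization.AtPrime p)] : IsDiscreteValuationRing (Localization.AtPrime p) := by
  have hint := (hA p).2
  have hnoeth : IsNoetherianRing (Localization.AtPrime p) :=
    IsLocalization.isNoetherianRing p.primeCompl _ inferInstance
  set m := IsLocalRing.maximalIdeal (Localization.AtPrime p) with hm
  have hheight : m.height = 1 := by
    rw [← IsLocalization.height_under p.primeCompl, hm, Localization.AtPrime.under_maximalIdeal, hp]
  have hne : m ≠ ⊥ := Ideal.ne_bot_of_height_eq_one hheight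
  have htfae := IsDiscreteValuationRing.TFAE (Localization.AtPrime p)
    (IsLocalRing.isField_iff_maximalIdeal_eq.not.2 hne)
  refine (htfae.out 0 3 : _ ↔ IsIntegrallyClosed (Localization.AtPrime p) ∧
    ∃! P : Ideal (Localization.AtPrime p), P ≠ ⊥ ∧ P.IsPrime).2
    ⟨hint, m, ⟨hne, inferInstance⟩, fun P ⟨hP, hPp⟩ => ?_⟩
  refine Ideal.eq_of_le_of_height_le P (IsLocalRing.le_maximalIdeal hPp.ne_top) ?_
  rw [hheight, Order.one_le_iff_pos, pos_iff_ne_zero, Ne, Ideal.height_eq_zero_iff_eq_bot]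
  exact hP

theorem HasCodimAtLeast.isSquarefreeElement {A : Type*} [CommRing A] [IsNoetherianRing A]
    (hA : IsNormalRing A) {d : A} (h : HasCodimAtLeast (vanishingOrderTwoLocus d) 2) :
    IsSquarefreeElement d := by
  intro p hpp hp
  have hdom := (hA p).1
  have hdvr := hA.isDiscreteValuationRing p hp
  refine ⟨hdom, hdvr, ?_⟩
  by_contra! hv
  obtain ⟨ϖ, hϖ⟩ := IsDiscreteValuationRing.exists_irreducible (Localization.AtPrime p)
  have h2 : 2 ≤ IsDiscreteValuationRing.addVal (Localization.AtPrime p)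
      (algebraMap A (Localization.AtPrime p) d) := by
    have h1 := Order.one_le_iff_pos.2 (pos_iff_ne_zero.2 hv.1)
    have := Order.add_one_le_of_lt (lt_of_le_of_ne h1 hv.2.symm)
    rwa [one_add_one_eq_two] at this
  have hdvd : ϖ ^ 2 ∣ algebraMap A (Localization.AtPrime p) d := by
    rw [← IsDiscreteValuationRing.addVal_le_iff_dvd, hϖ.addVal_pow]
    exact h2
  have hmem : (⟨p, hpp⟩ : PrimeSpectrum A) ∈ vanishingOrderTwoLocus d :=
    Ideal.mem_of_dvd _ hdvd (Ideal.pow_mem_pow hϖ.not_isUnit 2)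
  have := h _ hmem
  rw [hp] at this
  exact absurd this (by norm_num)

/-! ### Localization on the base and conclusion -/

section

attribute [local instance] Algebra.TensorProduct.rightAlgebra

/-- Normality of an algebra can be checked after localizing at the primes of the base. -/
theorem IsNormalRing.of_localization_base {A B : Type u} [CommRing A] [CommRing B] [Algebra A B]
    (h : ∀ (p : Ideal A) [p.IsPrime], IsNormalRing (Localization.AtPrime p ⊗[A] B)) :
    IsNormalRing B := by
  intro q hq
  let p := q.under A
  let M := Algebra.algebraMapSubmonoid B p.primeCompl
  have hdisj : Disjoint (M : Set B) q := by
    rw [Set.disjoint_left]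
    rintro _ ⟨a, ha, rfl⟩ haq
    exact ha haq
  let B' := Localization.AtPrime p ⊗[A] B
  have hloc : IsLocalization M B' := IsLocalization.tensorRight _ _
  have hprime : (q.map (algebraMap B B')).IsPrime :=
    IsLocalization.isPrime_of_isPrime_disjoint M B' q hq hdisj
  have hunder : (q.map (algebraMap B B')).comap (algebraMap B B') = q :=
    IsLocalization.under_map_of_isPrime_disjoint M B' hq hdisj
  have hat := IsLocalization.isLocalization_isLocalization_atPrime_isLocalization M
    (Localization.AtPrime (q.map (algebraMap B B'))) (q.map (algebraMap B B'))
  -- Localizing B' at the extension of q is the same as localizing B at q, since that extension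
  -- contracts to q.
  have hat' : IsLocalization.AtPrime (Localization.AtPrime (q.map (algebraMap B B'))) q := by
    convert! hat
    exact hunder.symm
  let e : Localization.AtPrime (q.map (algebraMap B B')) ≃ₐ[B] Localization.AtPrime q :=
    IsLocalization.algEquiv q.primeCompl _ _
  obtain ⟨hdom, hint⟩ := h p (q.map (algebraMap B B'))
  let e' : Localization.AtPrime (q.map (algebraMap B B')) ≃+* Localization.AtPrime q :=
    e.toRingEquiv
  exact ⟨e'.symm.toMulEquiv.isDomain _, IsIntegrallyClosed.of_equiv (h := hint) e'⟩

end

theorem mainTheorem10 {A : Type*} [CommRing A] [IsNoetherianRing A] (f : A[X]) (hf : f.Monic)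
    (hA : IsNormalRing A) (hΔ : f.discr ∈ nonZeroDivisors A)
    (hcodim : HasCodimAtLeast (vanishingOrderTwoLocus f.discr) 2) :
    IsSquarefreeElement f.discr ∧ IsNormalRing (SplittingRing f) := by
  refine ⟨hcodim.isSquarefreeElement hA, IsNormalRing.of_localization_base (A := A) fun p _ => ?_⟩
  obtain ⟨hdom, hint⟩ := hA p
  have hnoeth : IsNoetherianRing (Localization.AtPrime p) :=
    IsLocalization.isNoetherianRing p.primeCompl _ inferInstance
  have hflat := SplittingRing.flat hf
  have hdiscr : (f.map (algebraMap A (Localization.AtPrime p))).discr =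
      algebraMap A (Localization.AtPrime p) f.discr := hf.discr_map _
  -- Base change of the splitting-algebra property avoids identifying the tensor product with the
  -- splitting ring of the localized polynomial.
  refine (SplittingRing.isSplittingAlgebra hf).baseChange.isNormalRing
    (K := FractionRing (Localization.AtPrime p)) (hf.map _) (hf.natDegree_map _) ?_ fun t ht => ?_
  · rw [hdiscr]
    exact nonZeroDivisors.ne_zero (IsLocalization.map_nonZeroDivisors_le p.primeCompl _ ⟨_, hΔ, rfl⟩)
  · rw [hdiscr] at ht
    exact (hcodim.localization p.primeCompl).exists_algebraMap_eq ht
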